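/- Let $G\le \mathrm{PGL}(2,\mathbb Z)$ be a subgroup of finite index, acting on the upper half-plane $\mathbb H$ (antiholomorphically for determinant $-1$), let $X_G=G\backslash\mathbb H$, let $\overline{X_G}$ be its compactification by cusps, and let $\mathbb P=\mathrm{PGL}(2,\mathbb Z)/G$ with base point $t_0=G$. For $\alpha,\beta\in\mathbb H\cup\mathbb P^1(\mathbb Q)$ let $\{\alpha,\beta\}_G\in H_1(\overline{X_G},\mathbb R)$ be the real homology class defined by integrating, along the geodesic arc from $\alpha$ to $\beta$, the lifts to $\mathbb H$ of the real harmonic one-forms $\mathrm{Re}\,\omega$ on $\overline{X_G}$ (for $G\le\mathrm{PSL}(2,\mathbb Z)$, $\omega$ runs over the differentials of the first kind). For $\beta\in\mathbb R\smallsetminus\mathbb Q$ and a complete geodesic of $\mathbb H$ with one end at $\beta$, let $x_0$ be any point on it, let $y(\tau)$ be the point on it at distance $\tau$ from $x_0$ towards $\beta$, and put $$\{\{*,\beta\}\}_G:=\lim_{\tau\to\infty}\frac1\tau\{x_0,y(\tau)\}_G$$ whenever this limit exists. Let $$T(\beta,t)=\left(\frac1\beta-\left[\frac1\beta\right],\begin{pmatrix}-[1/\beta]&1\\1&0\end{pmatrix}t\right)$$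 be the shift on $[0,1]\times\mathbb P$; write $T$ also for its first component, and write $T^kt_0$ for the second component of $T^k(\beta,t_0)$. For $s=hG\in\mathbb P$ put $\varphi(s)=\{g(0),g(i\infty)\}_G$ with $g=h^{-1}$ (this is independent of the choice of $h$). For $c\in\mathbb R$ let $L_c$ be the set of irrational $\beta\in[0,1]$ with $\lim_{n\to\infty}\frac1n\log|(T^n)'(\beta)|=c$. Theorem. Let $c\in\mathbb R$ and $\beta\in L_c$. Then, for every geodesic ending at $\beta$ and every base point $x_0$ on it, the limit defining $\{\{*,\beta\}\}_G$ exists if and only if the limit on the right-hand side below exists, and in that case $$\{\{*,\beta\}\}_G=-\lim_{n\to\infty}\frac1{cn}\sum_{k=1}^n\varphi(T^kt_0).$$ -/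

import Mathlib

open scoped MatrixGroups ModularForm UpperHalfPlane Topology
open UpperHalfPlane Filter MeasureTheory Matrix

noncomputable section

namespace LMS

/-! ## The group and its weight two forms -/

/-- The inclusion of `GL(2, ℤ)` into `GL(2, ℝ)`. -/
def toReal : GL (Fin 2) ℤ →* GL (Fin 2) ℝ :=
  Matrix.GeneralLinearGroup.map (Int.castRingHom ℝ)

/-- The group of all real matrices that represent elements of `G ≤ PGL(2, ℤ)`. -/
def levelGroup (G : Subgroup PGL(2, ℤ)) : Subgroup (GL (Fin 2) ℝ) :=
  (G.comap Matrix.ProjGenLinGroup.mk).map toReal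

/-- The differentials of the first kind on the compactification of `X_G = G \ ℍ`, as a real vector
space: `f` stands for the differential `ω` whose lift to `ℍ` is `2 π i f(z) dz`.
Elements of determinant `-1` act on `ℍ` antiholomorphically, and Mathlib's invariance condition
for such a `γ` says `γ^* ω = conj ω`; so for every `G` the forms `Re ω` are exactly the real
harmonic one-forms on the compactification of `X_G`. If `G` is contained in `PSL(2, ℤ)` this is the
usual space of weight two cusp forms. -/
abbrev FirstKind (G : Subgroup PGL(2, ℤ)) : Type := CuspForm (levelGroup G) 2

/-- `H₁(X_G, ℝ)` for the compactified curve, as the dual of the space of real harmonic one-forms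
`Re ω`: a class `C` is determined by the numbers `C ω = Re ∫_C ω`, with `ω` of the first kind. -/
def RealHomology (G : Subgroup PGL(2, ℤ)) : Type := Module.Dual ℝ (FirstKind G)

instance (G : Subgroup PGL(2, ℤ)) : AddCommGroup (RealHomology G) :=
  inferInstanceAs (AddCommGroup (Module.Dual ℝ (FirstKind G)))

instance (G : Subgroup PGL(2, ℤ)) : Module ℝ (RealHomology G) :=
  inferInstanceAs (Module ℝ (Module.Dual ℝ (FirstKind G)))

/-- The value `C ω = Re ∫_C ω` of a homology class on a differential of the first kind. -/
def RealHomology.eval {G : Subgroup PGL(2, ℤ)} (C : RealHomology G) (f : FirstKind G) : ℝ :=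
  DFunLike.coe (F := Module.Dual ℝ (FirstKind G)) C f

/-- `H₁(X_G, ℝ)` carries the topology of pointwise convergence on differentials, which is the usual
topology of this finite-dimensional space when `G` has finite index. -/
instance (G : Subgroup PGL(2, ℤ)) : TopologicalSpace (RealHomology G) :=
  TopologicalSpace.induced (fun C : RealHomology G => C.eval) inferInstance

/-! ## Geodesics and integrals along them -/

/-- The geodesic `s ↦ g • (i e^s)` of `ℍ`, from `g • 0` to `g • i∞`, parametrized by hyperbolic arc
length. Every oriented complete geodesic, with every choice of base point `s = 0`, is of this
form. -/
def geodesic (g : GL (Fin 2) ℝ) (s : ℝ) : ℍ := g • UpperHalfPlane.mk ⟨0, Real.exp s⟩ (Real.exp_pos s)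

/-- The real part of the pull-back of `2 π i f(z) dz` to a geodesic. -/
def integrand {G : Subgroup PGL(2, ℤ)} (f : FirstKind G) (g : GL (Fin 2) ℝ) (s : ℝ) : ℝ :=
  (2 * Real.pi * Complex.I * f (geodesic g s) * deriv (fun u : ℝ => (geodesic g u : ℂ)) s).re

lemma geodesic_hasDerivAt (g : GL (Fin 2) ℝ) (s : ℝ) :
    HasDerivAt (fun u : ℝ => (geodesic g u : ℂ))
      (σ g (g.det.val / denom g (⟨0, Real.exp s⟩ : ℂ) ^ 2 * (⟨0, Real.exp s⟩ : ℂ))) s := by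
  have hz : ∀ u : ℝ, (⟨0, Real.exp u⟩ : ℂ) = Complex.I * (Real.exp u : ℝ) := by
    intro u; apply Complex.ext <;> simp [-Complex.ofReal_exp]
  have h0 : HasDerivAt (fun u : ℝ => (⟨0, Real.exp u⟩ : ℂ)) (⟨0, Real.exp s⟩ : ℂ) s := by
    simp_rw [hz]
    exact ((Real.hasDerivAt_exp s).ofReal_comp).const_mul _
  have hd : denom g (⟨0, Real.exp s⟩ : ℂ) ≠ 0 :=
    denom_ne_zero_of_im g (by simp)
  have hn : HasDerivAt (fun u : ℝ => num g (⟨0, Real.exp u⟩ : ℂ))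
      ((g 0 0 : ℂ) * (⟨0, Real.exp s⟩ : ℂ)) s := (h0.const_mul _).add_const _
  have hdn : HasDerivAt (fun u : ℝ => denom g (⟨0, Real.exp u⟩ : ℂ))
      ((g 1 0 : ℂ) * (⟨0, Real.exp s⟩ : ℂ)) s := (h0.const_mul _).add_const _
  have hq := hn.div hdn hd
  have hσ := ((σ g).toContinuousLinearEquiv.toContinuousLinearMap.hasFDerivAt
    (x := num g (⟨0, Real.exp s⟩ : ℂ) / denom g (⟨0, Real.exp s⟩ : ℂ))).comp_hasDerivAt s hq
  convert! hσ using 1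
  change σ g _ = σ g _
  congr 1
  rw [Matrix.GeneralLinearGroup.val_det_apply, Matrix.det_fin_two]
  simp only [num, denom] at hd ⊢
  field_simp
  push_cast
  ring

lemma continuous_geodesic (g : GL (Fin 2) ℝ) : Continuous (geodesic g) := by
  rw [UpperHalfPlane.isEmbedding_coe.continuous_iff]
  exact continuous_iff_continuousAt.2 fun s => (geodesic_hasDerivAt g s).continuousAt

lemma continuous_integrand {G : Subgroup PGL(2, ℤ)} (f : FirstKind G) (g : GL (Fin 2) ℝ) :
    Continuous (integrand f g) := by
  have h1 : Continuous f := ModularFormClass.continuous f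
  have h2 : deriv (fun u : ℝ => (geodesic g u : ℂ)) = fun s : ℝ =>
      σ g (g.det.val / denom g (⟨0, Real.exp s⟩ : ℂ) ^ 2 * (⟨0, Real.exp s⟩ : ℂ)) :=
    funext fun s => (geodesic_hasDerivAt g s).deriv
  have hz : ∀ u : ℝ, (⟨0, Real.exp u⟩ : ℂ) = Complex.I * (Real.exp u : ℝ) := by
    intro u; apply Complex.ext <;> simp [-Complex.ofReal_exp]
  have h3 : Continuous (deriv (fun u : ℝ => (geodesic g u : ℂ))) := by
    rw [h2]
    refine (σ g).continuous.comp ?_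
    have hc : Continuous fun s : ℝ => (⟨0, Real.exp s⟩ : ℂ) := by simp_rw [hz]; fun_prop
    refine (Continuous.div continuous_const ?_ ?_).mul hc
    · unfold denom; fun_prop
    · intro s
      exact pow_ne_zero _ (denom_ne_zero_of_im g (by simp))
  have h4 := h1.comp (continuous_geodesic g)
  unfold integrand
  exact Complex.continuous_re.comp ((continuous_const.mul h4).mul h3)

lemma norm_integrand_le {G : Subgroup PGL(2, ℤ)} (f : FirstKind G) (g : GL (Fin 2) ℝ) (s : ℝ) :
    |integrand f g s| ≤ 2 * Real.pi * (‖(⇑f ∣[(2 : ℤ)] g)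
      (UpperHalfPlane.mk ⟨0, Real.exp s⟩ (Real.exp_pos s))‖ * Real.exp s) := by
  refine (Complex.abs_re_le_norm _).trans (le_of_eq ?_)
  have hI : ‖(⟨0, Real.exp s⟩ : ℂ)‖ = Real.exp s := by
    have : (⟨0, Real.exp s⟩ : ℂ) = Complex.I * (Real.exp s : ℝ) := by
      apply Complex.ext <;> simp [-Complex.ofReal_exp]
    rw [this, norm_mul, Complex.norm_I, one_mul, Complex.norm_real, Real.norm_of_nonneg
      (Real.exp_pos s).le]
  rw [(geodesic_hasDerivAt g s).deriv, ModularForm.slash_def]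
  simp only [norm_mul, norm_σ, norm_div, norm_pow, hI, Complex.norm_real, Complex.norm_I,
    Real.norm_eq_abs, abs_abs, norm_zpow, abs_of_pos Real.pi_pos, geodesic]
  norm_num
  ring_nf

lemma toReal_injective : Function.Injective toReal := by
  intro a b h
  apply Units.ext
  ext i j
  have := congrArg (fun m : GL (Fin 2) ℝ => m i j) h
  simpa [toReal] using this

lemma isArithmetic_levelGroup (G : Subgroup PGL(2, ℤ)) [G.FiniteIndex] :
    (levelGroup G).IsArithmetic := by
  have hSL : 𝒮ℒ = ((Matrix.GeneralLinearGroup.det : GL (Fin 2) ℤ →* ℤˣ).ker).map toReal := by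
    ext x
    constructor
    · rintro ⟨m, rfl⟩
      refine ⟨Matrix.SpecialLinearGroup.toGL m, ?_, ?_⟩
      · exact MonoidHom.mem_ker.2 (Units.ext (by simp))
      · ext i j; simp [toReal]
    · rintro ⟨m, hm, rfl⟩
      have hm' : m.1.det = 1 := congrArg Units.val (MonoidHom.mem_ker.1 hm)
      exact ⟨⟨m.1, hm'⟩, by ext i j; rfl⟩
  have : (Matrix.GeneralLinearGroup.det : GL (Fin 2) ℤ →* ℤˣ).ker.FiniteIndex := inferInstance
  have : (G.comap (Matrix.ProjGenLinGroup.mk (n := Fin 2) (R := ℤ))).FiniteIndex :=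
    ⟨by rw [Subgroup.index_comap_of_surjective _ Matrix.ProjGenLinGroup.mk_surjective]
        exact Subgroup.FiniteIndex.index_ne_zero⟩
  constructor
  rw [hSL, levelGroup]
  constructor
  · rw [Subgroup.relIndex_map_map_of_injective _ _ toReal_injective]
    exact fun h => Subgroup.FiniteIndex.index_ne_zero (Subgroup.index_eq_zero_of_relIndex_eq_zero h)
  · rw [Subgroup.relIndex_map_map_of_injective _ _ toReal_injective]
    exact fun h => Subgroup.FiniteIndex.index_ne_zero (Subgroup.index_eq_zero_of_relIndex_eq_zero h)

open ConjAct Pointwise in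
lemma slash_decay {G : Subgroup PGL(2, ℤ)} [G.FiniteIndex] (f : FirstKind G)
    (g : GL (Fin 2) ℤ) :
    ∃ c > 0, (⇑f ∣[(2 : ℤ)] toReal g) =O[atImInfty] fun z => Real.exp (-c * z.im) := by
  have := isArithmetic_levelGroup G
  have : (toConjAct (toReal g)⁻¹ • levelGroup G).IsArithmetic := by
    convert Subgroup.IsArithmetic.conj (levelGroup G)
      (Matrix.GeneralLinearGroup.map (Int.castRingHom ℚ) g⁻¹) using 3
    ext i j
    simp [toReal, ← map_inv]
  exact CuspFormClass.exp_decay_atImInfty' (CuspForm.translate f (toReal g))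

lemma integrand_integrableOn {G : Subgroup PGL(2, ℤ)} [G.FiniteIndex] (f : FirstKind G)
    (g : GL (Fin 2) ℤ) : IntegrableOn (integrand f (toReal g)) (Set.Ioi 0) := by
  obtain ⟨c, hc, hO⟩ := slash_decay f g
  have ht : Tendsto (fun s : ℝ => UpperHalfPlane.mk ⟨0, Real.exp s⟩ (Real.exp_pos s)) atTop
      atImInfty := by
    rw [atImInfty, tendsto_comap_iff]
    exact Real.tendsto_exp_atTop
  have h1 := hO.comp_tendsto ht
  refine integrable_of_isBigO_exp_neg one_pos (continuous_integrand f _).continuousOn ?_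
  have h2 : integrand f (toReal g) =O[atTop]
      fun s : ℝ => Real.exp (-c * Real.exp s) * Real.exp s := by
    refine Asymptotics.IsBigO.trans (Asymptotics.IsBigO.of_bound (2 * Real.pi) ?_)
      (h1.norm_left.mul (Asymptotics.isBigO_refl Real.exp atTop))
    refine Eventually.of_forall fun s => ?_
    have := norm_integrand_le f (toReal g) s
    rw [Real.norm_eq_abs]
    refine this.trans (le_of_eq ?_)
    simp [-Complex.ofReal_exp]
  have h3 : (fun s : ℝ => Real.exp (-c * Real.exp s) * Real.exp s) =O[atTop]
      fun s : ℝ => Real.exp (-1 * s) := by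
    have h4 := ((isLittleO_exp_neg_mul_rpow_atTop hc (-2)).comp_tendsto
      Real.tendsto_exp_atTop).isBigO.mul (Asymptotics.isBigO_refl Real.exp atTop)
    refine h4.congr (fun s => rfl) fun s => ?_
    simp only [Function.comp]
    rw [← Real.exp_mul, ← Real.exp_add]
    congr 1
    ring
  simpa using h2.trans h3

/-- The matrix of determinant one that reverses the geodesic from `0` to `i∞`. -/
def flip : GL (Fin 2) ℤ := Matrix.SpecialLinearGroup.toGL ModularGroup.S

lemma geodesic_flip (g : GL (Fin 2) ℤ) (s : ℝ) :
    geodesic (toReal (g * flip)) s = geodesic (toReal g) (-s) := by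
  rw [geodesic, geodesic, map_mul, mul_smul]
  congr 1
  have h : toReal flip = Matrix.SpecialLinearGroup.mapGL ℝ ModularGroup.S := by
    ext i j; rfl
  rw [h]
  change ModularGroup.S • UpperHalfPlane.mk ⟨0, Real.exp s⟩ (Real.exp_pos s) = _
  rw [modular_S_smul]
  ext
  have hz : ∀ u : ℝ, (⟨0, Real.exp u⟩ : ℂ) = Complex.I * (Real.exp u : ℝ) := by
    intro u; apply Complex.ext <;> simp [-Complex.ofReal_exp]
  simp only [hz]
  rw [Real.exp_neg]
  have : ((Real.exp s : ℝ) : ℂ) ≠ 0 := by exact_mod_cast (Real.exp_pos s).ne'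
  push_cast at this ⊢
  field_simp
  simp

/-- Differentials of the first kind are integrable along geodesics between cusps. -/
lemma integrable_integrand {G : Subgroup PGL(2, ℤ)} [G.FiniteIndex] (f : FirstKind G)
    (g : GL (Fin 2) ℤ) : Integrable (integrand f (toReal g)) := by
  have h1 := integrand_integrableOn f g
  have h2 := integrand_integrableOn f (g * flip)
  have h3 : integrand f (toReal (g * flip)) = fun s => -integrand f (toReal g) (-s) := by
    ext s
    unfold integrand
    simp_rw [geodesic_flip]
    rw [deriv_comp_neg (f := fun u : ℝ => ((geodesic (toReal g) u : ℍ) : ℂ))]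
    simp
  rw [h3] at h2
  have h4 : IntegrableOn (integrand f (toReal g)) (Set.Iio 0) := by
    have h5 := (Measure.measurePreserving_neg (volume : Measure ℝ)).integrableOn_comp_preimage
      (Homeomorph.neg ℝ).measurableEmbedding (f := integrand f (toReal g)) (s := Set.Iio 0)
    rw [← h5]
    simpa [Function.comp_def] using h2.neg
  rw [← integrableOn_univ, ← Set.Iic_union_Ioi (a := (0 : ℝ))]
  exact IntegrableOn.union (integrableOn_Iic_iff_integrableOn_Iio (by simp) |>.2 h4) h1

lemma integrand_add {G : Subgroup PGL(2, ℤ)} (f f' : FirstKind G) (g : GL (Fin 2) ℝ) (s : ℝ) :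
    integrand (f + f') g s = integrand f g s + integrand f' g s := by
  simp only [integrand, _root_.add_apply, ← Complex.add_re]
  congr 1
  ring

lemma integrand_smul {G : Subgroup PGL(2, ℤ)} (r : ℝ) (f : FirstKind G) (g : GL (Fin 2) ℝ)
    (s : ℝ) : integrand (r • f) g s = r * integrand f g s := by
  simp only [integrand, _root_.smul_apply, Complex.real_smul, ← Complex.re_ofReal_mul]
  congr 1
  ring

/-! ## Modular symbols -/

/-- The class `{x, y}_G` for the two points `x = γ(a)` and `y = γ(b)` of the geodesic `γ` given by
`g`: integration along the arc of `γ` from `x` to `y`. -/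
def arcSymbol (G : Subgroup PGL(2, ℤ)) (g : GL (Fin 2) ℝ) (a b : ℝ) : RealHomology G :=
  show Module.Dual ℝ (FirstKind G) from
  { toFun := fun f => ∫ s in a..b, integrand f g s
    map_add' := fun f f' => by
      simp_rw [integrand_add]
      exact intervalIntegral.integral_add ((continuous_integrand f g).intervalIntegrable _ _)
        ((continuous_integrand f' g).intervalIntegrable _ _)
    map_smul' := fun r f => by
      simp_rw [integrand_smul]
      exact intervalIntegral.integral_const_mul _ _ }

/-- The modular symbol `{g(0), g(i∞)}_G` for `g ∈ GL(2, ℤ)`: integration along the geodesic from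
the cusp `g(0)` to the cusp `g(i∞)`. -/
def cuspSymbol (G : Subgroup PGL(2, ℤ)) [G.FiniteIndex] (g : GL (Fin 2) ℤ) : RealHomology G :=
  show Module.Dual ℝ (FirstKind G) from
  { toFun := fun f => ∫ s : ℝ, integrand f (toReal g) s
    map_add' := fun f f' => by
      simp_rw [integrand_add]
      exact integral_add (integrable_integrand f g) (integrable_integrand f' g)
    map_smul' := fun r f => by
      simp_rw [integrand_smul]
      exact integral_const_mul _ _ }

/-- The geodesic given by `g` tends to the real number `β` (its other end is any other point of
the real projective line). -/
def EndsAt (g : GL (Fin 2) ℝ) (β : ℝ) : Prop := g • (OnePoint.infty : OnePoint ℝ) = (β : OnePoint ℝ)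

/-- `C` is the limiting modular symbol `{{*, β}}_G = lim (1/τ) {x₀, y(τ)}_G`, as computed with the
geodesic given by `g`, which ends at `β`; here `x₀` is its point of parameter `0` and `y(τ)` the
point at distance `τ` from `x₀` towards `β`. -/
def IsLimitingSymbol (G : Subgroup PGL(2, ℤ)) (g : GL (Fin 2) ℝ) (C : RealHomology G) : Prop :=
  Tendsto (fun τ : ℝ => τ⁻¹ • arcSymbol G g 0 τ) atTop (𝓝 C)

/-! ## The shift and the Lyapunov exponent -/

/-- The shift `β ↦ 1/β - ⌊1/β⌋` of the continued fraction expansion. -/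
def gauss (β : ℝ) : ℝ := 1 / β - ⌊1 / β⌋

/-- The level set `L_c` of the Lyapunov exponent `λ(β) = lim (1/n) log |(T^n)'(β)|`. Only irrational
points have an infinite forward orbit on which the shift and its derivative are defined. -/
def lyapunovLevel (c : ℝ) : Set ℝ :=
  {β | β ∈ Set.Icc (0 : ℝ) 1 ∧ Irrational β ∧
    Tendsto (fun n : ℕ => (1 / (n : ℝ)) * Real.log |deriv (gauss^[n]) β|) atTop (𝓝 c)}

/-- The matrix with rows `(-a, 1)` and `(1, 0)`. -/
def shiftMatrix (a : ℤ) : GL (Fin 2) ℤ :=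
  ⟨!![-a, 1; 1, 0], !![0, 1; 1, a],
    by ext i j; fin_cases i <;> fin_cases j <;> simp [Matrix.mul_apply, Fin.sum_univ_two],
    by ext i j; fin_cases i <;> fin_cases j <;> simp [Matrix.mul_apply, Fin.sum_univ_two]⟩

/-- The coset space `ℙ = PGL(2, ℤ) / G`. -/
abbrev Cosets (G : Subgroup PGL(2, ℤ)) : Type := PGL(2, ℤ) ⧸ G

/-- The shift `T (β, t) = (1/β - ⌊1/β⌋, M • t)`, where `M` has rows `(-⌊1/β⌋, 1)` and `(1, 0)`. -/
def shift (G : Subgroup PGL(2, ℤ)) (x : ℝ × Cosets G) : ℝ × Cosets G :=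
  (gauss x.1, Matrix.ProjGenLinGroup.mk (shiftMatrix ⌊1 / x.1⌋) • x.2)

lemma exists_rep (G : Subgroup PGL(2, ℤ)) (s : Cosets G) :
    ∃ h : GL (Fin 2) ℤ, ((Matrix.ProjGenLinGroup.mk h : PGL(2, ℤ)) : Cosets G) = s := by
  obtain ⟨p, rfl⟩ := QuotientGroup.mk_surjective s
  obtain ⟨h, rfl⟩ := Matrix.ProjGenLinGroup.mk_surjective p
  exact ⟨h, rfl⟩

/-- The function `φ : ℙ → H₁(X_G, ℝ)`. The symbol `{g(0), g(i∞)}_G` depends only on the right coset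
`G g`, so for the left coset `s = h G` one takes `g = h⁻¹`; the value does not depend on the
representative `h`. -/
def phi (G : Subgroup PGL(2, ℤ)) [G.FiniteIndex] (s : Cosets G) : RealHomology G :=
  cuspSymbol G (exists_rep G s).choose⁻¹

/-- The base point `t₀` of `ℙ`, the coset of the identity; `φ(t₀) = {0, i∞}_G`. -/
def basePoint (G : Subgroup PGL(2, ℤ)) : Cosets G := ((1 : PGL(2, ℤ)) : Cosets G)

end LMS

end

/-! Evaluated on one differential `f`, everything becomes a statement about a potential `Φ` of the
harmonic form `Re (2πi f dz)` on the half-plane. Since `‖f z‖ * z.im` is bounded, `Φ` is Lipschitz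
along geodesics, and since `f` is a cusp form it has boundary values at the cusps.

Let `g_n` be the matrix `convMatrix β n`, `x_n` the iterate `gauss^[n] β` and `D_n` the number
`convDenom β n`. The coset `T^n t₀` is represented by `g_n⁻¹`, so `φ(T^n t₀)` integrates from
`g_n(0)` to `g_n(i∞)`. These are consecutive convergents of `β`, with `g_{n+1}(i∞) = g_n(0)`; hence
the sum telescopes (`IsPotential.eval_sum_phi`), and its negative is the value of `Φ` at `g_n(0)`
minus its value at the cusp `0`. The cusp `g_n(0)` may be replaced by the point `g_n(i)` at bounded
cost, because finitely many cosets occur.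

By the chain rule `|(T^n)'(β)| = D_n ^ 2`. The point `g_n(i)` and the point of parameter `2 log D_n`
on any geodesic ending at `β` both have distance `O(D_n⁻²)` from `β` and height at least a constant
times `D_n⁻²`, so `Φ` differs boundedly between them (`IsPotential.exists_abs_sub_le`). On `L_c` one
has `2 log D_n ~ c n` with `c > 0`, and the Lipschitz bound turns averages over `n` into averages
over `τ` and back (`tendsto_inv_mul_iff`). -/

namespace LMS

variable {G : Subgroup PGL(2, ℤ)}

/-! ## Potentials of differentials of the first kind -/

/-- A potential of the harmonic form `Re (2 π i f(z) dz)`, with the constant `M` controlling its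
growth. -/
structure IsPotential (f : FirstKind G) (Φ : ℍ → ℝ) (M : ℝ) : Prop where
  nonneg : 0 ≤ M
  hasDerivAt : ∀ g s, HasDerivAt (fun u => Φ (geodesic g u)) (integrand f g s) s
  integrand_le : ∀ g s, |integrand f g s| ≤ M
  sub_le : ∀ (r : ℝ) (z w : ℍ), 0 < r → r ≤ z.im → r ≤ w.im →
    |Φ z - Φ w| ≤ M / r * dist (z : ℂ) w

lemma coe_mk_exp (s : ℝ) : (⟨0, Real.exp s⟩ : ℂ) = Complex.I * (Real.exp s : ℝ) := by
  apply Complex.ext <;> simp [-Complex.ofReal_exp]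

/-- The weight two factor is the derivative of the Möbius map. For negative determinant the action
is antiholomorphic; conjugating inside the real part changes the sign of `I`, which `det = -|det|`
compensates. Invariance under all of `levelGroup G` follows. -/
lemma integrand_eq_re_slash (f : FirstKind G) (g : GL (Fin 2) ℝ) (s : ℝ) :
    integrand f g s = (2 * Real.pi * Complex.I * ((⇑f ∣[(2 : ℤ)] g)
      (UpperHalfPlane.mk ⟨0, Real.exp s⟩ (Real.exp_pos s)) * ⟨0, Real.exp s⟩)).re := by
  rw [integrand, (geodesic_hasDerivAt g s).deriv, ModularForm.slash_def]
  simp only [geodesic]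
  have hd : denom g (⟨0, Real.exp s⟩ : ℂ) ≠ 0 := denom_ne_zero_of_im g (by simp)
  generalize f (g • UpperHalfPlane.mk ⟨0, Real.exp s⟩ (Real.exp_pos s)) = w
  have hg : g.det.val ≠ 0 := g.det.ne_zero
  rcases hg.lt_or_gt with h | h
  · have h' : ¬ 0 < g.det.val := not_lt.2 h.le
    have habs : |g.det.val| = -g.det.val := abs_of_neg h
    simp only [σ, if_neg h', habs, Complex.conjCAE_apply]
    rw [show ((2 : ℤ) - 1) = 1 from rfl, zpow_one, _root_.zpow_neg,
      show (denom g (⟨0, Real.exp s⟩ : ℂ)) ^ (2 : ℤ) = denom g (⟨0, Real.exp s⟩ : ℂ) ^ 2 from rfl]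
    set d := denom g (⟨0, Real.exp s⟩ : ℂ)
    set e : ℂ := (⟨0, Real.exp s⟩ : ℂ)
    rw [← Complex.conj_re]
    congr 1
    simp only [map_mul, map_div₀, map_pow, Complex.conj_conj, Complex.conj_I,
      Complex.conj_ofReal, map_ofNat, Complex.ofReal_neg]
    have hd' : (starRingEnd ℂ) d ≠ 0 := by simpa using hd
    field_simp
  · simp only [σ, if_pos h, abs_of_pos h, ContinuousAlgEquiv.refl_apply]
    congr 1
    rw [show ((2 : ℤ) - 1) = 1 from rfl, zpow_one, _root_.zpow_neg,
      show (denom g (⟨0, Real.exp s⟩ : ℂ)) ^ (2 : ℤ) = denom g (⟨0, Real.exp s⟩ : ℂ) ^ 2 from rfl]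
    field_simp

/-- The geodesic has unit hyperbolic speed, so its Euclidean speed is its height. -/
lemma abs_integrand_le (f : FirstKind G) (g : GL (Fin 2) ℝ) (s : ℝ) :
    |integrand f g s| ≤ 2 * Real.pi * (‖f (geodesic g s)‖ * (geodesic g s).im) := by
  refine (norm_integrand_le f g s).trans (le_of_eq ?_)
  rw [ModularForm.slash_def, geodesic, im_smul_eq_div_normSq, Complex.normSq_eq_norm_sq]
  simp only [norm_mul, norm_σ, Complex.norm_real, norm_zpow, Real.norm_eq_abs, abs_abs]
  norm_num [UpperHalfPlane.im]
  ring

lemma exists_norm_mul_im_le [G.FiniteIndex] (f : FirstKind G) :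
    ∃ C, 0 ≤ C ∧ ∀ z : ℍ, ‖f z‖ * z.im ≤ C := by
  have := isArithmetic_levelGroup G
  obtain ⟨C, hC⟩ := CuspFormClass.exists_bound f
  have h : ∀ z : ℍ, ‖f z‖ * z.im ≤ C := fun z => by
    have := hC z
    norm_num at this
    rwa [le_div_iff₀ z.im_pos] at this
  exact ⟨C, (mul_nonneg (norm_nonneg _) I.im_pos.le).trans (h I), h⟩

lemma exists_primitive (f : FirstKind G) :
    ∃ F : ℂ → ℂ, ∀ z : ℍ, HasDerivAt F (2 * Real.pi * Complex.I * f z) z := by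
  have h1 : DifferentiableOn ℂ (⇑f ∘ ofComplex) {z | 0 < z.im} :=
    UpperHalfPlane.mdifferentiable_iff.1 (CuspFormClass.holo f)
  obtain ⟨F, hF⟩ := (convex_halfSpace_im_gt 0).exists_forall_hasDerivWithinAt
    (h1.const_mul (2 * Real.pi * Complex.I))
  refine ⟨F, fun z => ?_⟩
  have := (hF z z.im_pos).hasDerivAt (isOpen_upperHalfPlaneSet.mem_nhds z.im_pos)
  simpa [ofComplex_apply] using this

/-- The real part of a holomorphic primitive works. If `‖f z‖ * z.im ≤ C`, then the primitive has
derivative at most `2πC / r` on the convex set `im ≥ r`, and the mean value inequality applies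
there. -/
lemma exists_isPotential [G.FiniteIndex] (f : FirstKind G) :
    ∃ (Φ : ℍ → ℝ) (M : ℝ), IsPotential f Φ M := by
  obtain ⟨C, hC0, hC⟩ := exists_norm_mul_im_le f
  obtain ⟨F, hF⟩ := exists_primitive f
  refine ⟨fun z => (F z).re, 2 * Real.pi * C, by positivity, fun g s => ?_, fun g s => ?_, ?_⟩
  · have h := geodesic_hasDerivAt g s
    have h2 := (hF (geodesic g s)).comp_of_eq s h.differentiableAt.hasDerivAt rfl
    exact Complex.reCLM.hasFDerivAt.comp_hasDerivAt s h2
  · refine (abs_integrand_le f g s).trans ?_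
    have := hC (geodesic g s)
    have := Real.pi_pos
    gcongr
  · intro r z w hr hz hw
    have key := Convex.norm_image_sub_le_of_norm_hasDerivWithin_le (𝕜 := ℂ) (f := F)
      (f' := fun u => 2 * Real.pi * Complex.I * f (ofComplex u)) (s := {u : ℂ | r ≤ u.im})
      (x := (w : ℂ)) (y := (z : ℂ)) (C := 2 * Real.pi * C / r) (fun u hu => ?_) (fun u hu => ?_)
      (convex_halfSpace_im_ge r) hw hz
    · rw [dist_eq_norm]
      refine le_trans ?_ key
      rw [← Complex.sub_re]
      exact Complex.abs_re_le_norm _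
    · have hu' : 0 < u.im := hr.trans_le hu
      have := hF ⟨u, hu'⟩
      rw [ofComplex_apply_of_im_pos hu']
      exact this.hasDerivWithinAt
    · have hu' : 0 < u.im := hr.trans_le hu
      rw [ofComplex_apply_of_im_pos hu']
      have h1 := hC ⟨u, hu'⟩
      have h2 : ‖f ⟨u, hu'⟩‖ * r ≤ C :=
        (mul_le_mul_of_nonneg_left hu (norm_nonneg _)).trans h1
      rw [mul_div_assoc, norm_mul]
      have h3 : ‖(2 * Real.pi * Complex.I : ℂ)‖ = 2 * Real.pi := by
        simp [abs_of_pos Real.pi_pos]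
      rw [h3]
      have := Real.pi_pos
      gcongr
      rwa [le_div_iff₀ hr]

/-- Points at hyperbolic distance `d` from `w` have height at least `w.im * exp (-d)`, where the
Euclidean estimate applies. The bound tends to `0` with `d`, so `Φ` has the same limit along
asymptotic geodesics. -/
lemma IsPotential.abs_sub_le_dist {f : FirstKind G} {Φ : ℍ → ℝ} {M : ℝ} (h : IsPotential f Φ M)
    (z w : ℍ) :
    |Φ z - Φ w| ≤ M * (Real.exp (dist z w) * (Real.exp (dist z w) - 1)) := by
  have hw : w.im / Real.exp (dist z w) ≤ z.im := by
    rw [dist_comm]; exact im_div_exp_dist_le w z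
  have he : 1 ≤ Real.exp (dist z w) := Real.one_le_exp dist_nonneg
  have hM := h.nonneg
  have := w.im_pos
  refine (h.sub_le (w.im / Real.exp (dist z w)) z w (by positivity) hw
    (div_le_self w.im_pos.le he)).trans ?_
  calc M / (w.im / Real.exp (dist z w)) * dist (z : ℂ) w
      ≤ M / (w.im / Real.exp (dist z w)) * (w.im * (Real.exp (dist z w) - 1)) := by
        gcongr
        exact dist_coe_le z w
    _ = _ := by field_simp

lemma IsPotential.abs_geodesic_sub_le {f : FirstKind G} {Φ : ℍ → ℝ} {M : ℝ}
    (h : IsPotential f Φ M) (g : GL (Fin 2) ℝ) (s t : ℝ) :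
    |Φ (geodesic g s) - Φ (geodesic g t)| ≤ M * |s - t| :=
  Convex.norm_image_sub_le_of_norm_hasDerivWithin_le (𝕜 := ℝ) (s := Set.univ)
    (fun x _ => (h.hasDerivAt g x).hasDerivWithinAt) (fun x _ => h.integrand_le g x) convex_univ
    (Set.mem_univ t) (Set.mem_univ s)

lemma IsPotential.integral_integrand {f : FirstKind G} {Φ : ℍ → ℝ} {M : ℝ}
    (h : IsPotential f Φ M) (g : GL (Fin 2) ℝ) (a b : ℝ) :
    ∫ s in a..b, integrand f g s = Φ (geodesic g b) - Φ (geodesic g a) :=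
  intervalIntegral.integral_eq_sub_of_hasDerivAt (fun s _ => h.hasDerivAt g s)
    ((continuous_integrand f g).intervalIntegrable _ _)

/-- All of `GL(2, ℝ)` acts on the upper half-plane by isometries. -/
lemma dist_smul_smul (g : GL (Fin 2) ℝ) (z w : ℍ) : dist (g • z) (g • w) = dist z w := by
  have hcoe : dist ((g • z : ℍ) : ℂ) (g • w : ℍ) =
      |g.det.val| * dist (z : ℂ) w / (‖denom g z‖ * ‖denom g w‖) := by
    have hz := denom_ne_zero g z
    have hw := denom_ne_zero g w
    have h1 : num g z / denom g z - num g w / denom g w =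
        g.det.val * (z - w) / (denom g z * denom g w) := by
      field_simp
      rw [Matrix.GeneralLinearGroup.val_det_apply, Matrix.det_fin_two]
      simp only [num, denom]
      push_cast
      ring
    rw [dist_eq_norm, coe_smul, coe_smul, ← map_sub, norm_σ, h1, norm_div, norm_mul, norm_mul,
      Complex.norm_real, Real.norm_eq_abs, dist_eq_norm]
  have h : Real.cosh (dist (g • z) (g • w)) = Real.cosh (dist z w) := by
    rw [cosh_dist, cosh_dist, hcoe, im_smul_eq_div_normSq, im_smul_eq_div_normSq,
      Complex.normSq_eq_norm_sq, Complex.normSq_eq_norm_sq]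
    have hz := norm_ne_zero_iff.2 (denom_ne_zero g z)
    have hw := norm_ne_zero_iff.2 (denom_ne_zero g w)
    have hd : |g.det.val| ≠ 0 := abs_ne_zero.2 g.det.ne_zero
    have := z.im_ne_zero
    have := w.im_ne_zero
    field_simp
  have h1 := Real.cosh_le_cosh.1 h.le
  have h2 := Real.cosh_le_cosh.1 h.ge
  rw [abs_of_nonneg dist_nonneg, abs_of_nonneg dist_nonneg] at h1 h2
  exact le_antisymm h1 h2

/-! ## Cosets, cusps and boundary values of potentials -/

lemma integrand_mul_of_mem (f : FirstKind G) {k : GL (Fin 2) ℝ} (hk : k ∈ levelGroup G)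
    (g : GL (Fin 2) ℝ) (s : ℝ) : integrand f (k * g) s = integrand f g s := by
  rw [integrand_eq_re_slash, integrand_eq_re_slash, SlashAction.slash_mul,
    SlashInvariantFormClass.slash_action_eq f k hk]

/-- If `hG = h'G` then `h⁻¹` and `h'⁻¹` differ by a left factor in `G`. This makes the choice of
representative in `phi` harmless. -/
lemma integrand_toReal_inv_congr (f : FirstKind G) {h h' : GL (Fin 2) ℤ}
    (hh : ((Matrix.ProjGenLinGroup.mk h : PGL(2, ℤ)) : Cosets G) =
      (Matrix.ProjGenLinGroup.mk h' : PGL(2, ℤ))) :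
    integrand f (toReal h⁻¹) = integrand f (toReal h'⁻¹) := by
  rw [QuotientGroup.eq] at hh
  have hk : toReal (h⁻¹ * h') ∈ levelGroup G :=
    Subgroup.mem_map_of_mem _ (by simpa [Subgroup.mem_comap] using hh)
  ext s
  rw [← integrand_mul_of_mem f hk (toReal h'⁻¹) s, ← map_mul]
  congr 2
  group

lemma phi_eval [G.FiniteIndex] (f : FirstKind G) (h : GL (Fin 2) ℤ) :
    (phi G ((Matrix.ProjGenLinGroup.mk h : PGL(2, ℤ)) : Cosets G)).eval f =
      ∫ s : ℝ, integrand f (toReal h⁻¹) s := by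
  change ∫ s : ℝ, integrand f (toReal (exists_rep G _).choose⁻¹) s = _
  rw [integrand_toReal_inv_congr f (exists_rep G _).choose_spec]

/-- The integrals along half of a geodesic between cusps take finitely many values. -/
lemma exists_integral_Ioi_le [G.FiniteIndex] (f : FirstKind G) :
    ∃ B, ∀ g : GL (Fin 2) ℤ, |∫ s in Set.Ioi 0, integrand f (toReal g) s| ≤ B := by
  have : Finite (Cosets G) := Subgroup.finite_quotient_of_finiteIndex
  obtain ⟨B, hB⟩ := (Set.finite_range fun t : Cosets G =>
    |∫ s in Set.Ioi 0, integrand f (toReal (exists_rep G t).choose⁻¹) s|).bddAbove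
  refine ⟨B, fun g => ?_⟩
  have := hB ⟨((Matrix.ProjGenLinGroup.mk g⁻¹ : PGL(2, ℤ)) : Cosets G), rfl⟩
  simp only at this
  rwa [integrand_toReal_inv_congr f (exists_rep G _).choose_spec, inv_inv] at this

/-- The value at the cusp `g • i∞` of a potential `Φ` of `f`. -/
noncomputable def cuspValue (f : FirstKind G) (Φ : ℍ → ℝ) (g : GL (Fin 2) ℤ) : ℝ :=
  Φ (geodesic (toReal g) 0) + ∫ s in Set.Ioi 0, integrand f (toReal g) s

variable {f : FirstKind G} {Φ : ℍ → ℝ} {M : ℝ}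

lemma IsPotential.tendsto_cuspValue [G.FiniteIndex] (h : IsPotential f Φ M) (g : GL (Fin 2) ℤ) :
    Tendsto (fun s => Φ (geodesic (toReal g) s)) atTop (𝓝 (cuspValue f Φ g)) := by
  have := intervalIntegral_tendsto_integral_Ioi 0 (integrand_integrableOn f g) tendsto_id
  simp only [id, h.integral_integrand] at this
  simpa [cuspValue] using this.const_add (Φ (geodesic (toReal g) 0))

/-- The initial end `g • 0` is the cusp `(g * flip) • i∞`, as `flip` reverses the geodesic. -/
lemma IsPotential.integral_eq_cuspValue_sub [G.FiniteIndex] (h : IsPotential f Φ M)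
    (g : GL (Fin 2) ℤ) :
    ∫ s : ℝ, integrand f (toReal g) s = cuspValue f Φ g - cuspValue f Φ (g * flip) := by
  refine integral_of_hasDerivAt_of_tendsto (h.hasDerivAt _) (integrable_integrand f g) ?_
    (h.tendsto_cuspValue g)
  have := (h.tendsto_cuspValue (g * flip)).comp tendsto_neg_atBot_atTop
  simpa only [Function.comp_def, geodesic_flip, neg_neg] using this

/-- The value at a cusp does not depend on the geodesic along which the cusp is approached. -/
lemma IsPotential.cuspValue_mul [G.FiniteIndex] (h : IsPotential f Φ M) (g N : GL (Fin 2) ℤ)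
    (hN : N 1 0 = 0) : cuspValue f Φ (g * N) = cuspValue f Φ g := by
  have hdet : N 0 0 * N 1 1 = N.det.val := by
    rw [Matrix.GeneralLinearGroup.val_det_apply, Matrix.det_fin_two, hN]; ring
  have h00 : N 0 0 * N 1 1 = 1 ∨ N 0 0 * N 1 1 = -1 := by
    rw [hdet]; exact Int.isUnit_iff.1 N.det.isUnit
  have h11abs : |(N 1 1 : ℝ)| = 1 := by
    have hu : IsUnit (N 0 0 * N 1 1) := hdet ▸ N.det.isUnit
    rw [IsUnit.mul_iff, Int.isUnit_iff_abs_eq, Int.isUnit_iff_abs_eq] at hu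
    exact_mod_cast hu.2
  -- On the imaginary axis `N` is a horizontal translation by `N 0 1 / N 1 1`, also when the
  -- determinant is `-1`, because `z ↦ -conj z` fixes the axis. At height `exp s` this moves points
  -- by at most `|N 0 1| / exp s`.
  have hdist : ∀ s : ℝ, dist (geodesic (toReal (g * N)) s) (geodesic (toReal g) s) ≤
      |(N 0 1 : ℝ)| / Real.exp s := by
    intro s
    rw [geodesic, geodesic, map_mul, mul_smul, dist_smul_smul]
    refine (dist_le_dist_coe_div_sqrt _ _).trans ?_
    have hcoe : ((toReal N • UpperHalfPlane.mk ⟨0, Real.exp s⟩ (Real.exp_pos s) : ℍ) : ℂ) =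
        Complex.I * (Real.exp s : ℝ) + ((N 0 1 / N 1 1 : ℝ) : ℂ) := by
      have hd : (toReal N).det.val = ((N 0 0 * N 1 1 : ℤ) : ℝ) := by
        rw [Matrix.GeneralLinearGroup.val_det_apply, Matrix.det_fin_two]
        change ((N 0 0 : ℤ) : ℝ) * ((N 1 1 : ℤ) : ℝ) - ((N 0 1 : ℤ) : ℝ) * ((N 1 0 : ℤ) : ℝ) = _
        rw [hN]
        push_cast
        ring
      have h11 : (N 1 1 : ℂ) ≠ 0 := by
        have : N 1 1 ≠ 0 := by rintro h0; simp [h0] at h00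
        exact_mod_cast this
      rw [coe_smul, num, denom]
      change σ (toReal N) ((((N 0 0 : ℤ) : ℝ) * (⟨0, Real.exp s⟩ : ℂ) + ((N 0 1 : ℤ) : ℝ)) /
        (((N 1 0 : ℤ) : ℝ) * (⟨0, Real.exp s⟩ : ℂ) + ((N 1 1 : ℤ) : ℝ))) = _
      rw [coe_mk_exp, hN, σ, hd]
      rcases h00 with h1 | h1
      · have h2 : (N 0 0 : ℂ) / N 1 1 = 1 := by
          rw [div_eq_one_iff_eq h11]
          have : N 0 0 = N 1 1 := Int.eq_of_mul_eq_one h1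
          exact_mod_cast this
        simp only [h1, Int.cast_one, zero_lt_one, if_true, ContinuousAlgEquiv.refl_apply]
        push_cast
        rw [zero_mul, zero_add, add_div, mul_div_right_comm, h2, one_mul]
      · have h2 : (N 0 0 : ℂ) / N 1 1 = -1 := by
          rw [div_eq_iff h11]
          have : N 0 0 * -N 1 1 = 1 := by linarith
          have : N 0 0 = -N 1 1 := Int.eq_of_mul_eq_one this
          rw [this]; push_cast; ring
        have hneg : ¬ (0 : ℝ) < ((-1 : ℤ) : ℝ) := by norm_num
        rw [h1, if_neg hneg]
        have h3 : ((((N 0 0 : ℤ) : ℝ) : ℂ) * (Complex.I * (Real.exp s : ℝ)) + ((N 0 1 : ℤ) : ℝ)) /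
            (((0 : ℤ) : ℝ) * (Complex.I * (Real.exp s : ℝ)) + ((N 1 1 : ℤ) : ℝ)) =
            -(Complex.I * (Real.exp s : ℝ)) + ((N 0 1 / N 1 1 : ℝ) : ℂ) := by
          push_cast
          rw [zero_mul, zero_add, add_div, mul_div_right_comm, h2, neg_one_mul]
        rw [h3, Complex.conjCAE_apply]
        simp [-Complex.ofReal_exp]
    have him : (toReal N • UpperHalfPlane.mk ⟨0, Real.exp s⟩ (Real.exp_pos s)).im =
        Real.exp s := by
      rw [← coe_im, hcoe]
      simp [-Complex.ofReal_exp]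
    rw [him, hcoe, dist_eq_norm]
    change ‖_ - (⟨0, Real.exp s⟩ : ℂ)‖ / √ (Real.exp s * Real.exp s) ≤ _
    rw [Real.sqrt_mul_self (Real.exp_pos s).le, coe_mk_exp, add_sub_cancel_left,
      Complex.norm_real, Real.norm_eq_abs, abs_div, h11abs, div_one]
  have hd0 : Tendsto (fun s => dist (geodesic (toReal (g * N)) s) (geodesic (toReal g) s)) atTop
      (𝓝 0) :=
    squeeze_zero (fun _ => dist_nonneg) hdist
      (tendsto_const_nhds.div_atTop Real.tendsto_exp_atTop)
  have he := (Real.continuous_exp.tendsto 0).comp hd0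
  have hlim : Tendsto (fun s => Φ (geodesic (toReal (g * N)) s) - Φ (geodesic (toReal g) s)) atTop
      (𝓝 0) := by
    refine squeeze_zero_norm (fun s => h.abs_sub_le_dist _ _) ?_
    simpa using (he.mul (he.sub_const 1)).const_mul M
  exact sub_eq_zero.1
    (tendsto_nhds_unique ((h.tendsto_cuspValue (g * N)).sub (h.tendsto_cuspValue g)) hlim)

/-- Both matrices send `i∞` to `g • 0`, so they differ by an upper triangular factor. This is what
makes the sum of `φ` telescope. -/
lemma IsPotential.cuspValue_mul_flip [G.FiniteIndex] (h : IsPotential f Φ M) (g : GL (Fin 2) ℤ)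
    (a : ℤ) : cuspValue f Φ (g * (shiftMatrix a)⁻¹) = cuspValue f Φ (g * flip) := by
  have h1 := h.cuspValue_mul (g * flip) (flip⁻¹ * (shiftMatrix a)⁻¹) (by
    change ((flip⁻¹).val * ((shiftMatrix a)⁻¹).val) 1 0 = 0
    rw [flip, ← map_inv]
    simp [Matrix.mul_apply, Fin.sum_univ_two, shiftMatrix, Matrix.inv_def,
      ModularGroup.coe_S, Matrix.adjugate_fin_two])
  rw [← h1]
  congr 1
  group

/-! ## Continued fractions -/

/-- The matrix with columns the numerators and denominators of two consecutive convergents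
of `β`. -/
noncomputable def convMatrix (β : ℝ) : ℕ → GL (Fin 2) ℤ
  | 0 => 1
  | n + 1 => convMatrix β n * (shiftMatrix ⌊1 / gauss^[n] β⌋)⁻¹

/-- The denominator of the convergent matrix at the complete quotient. -/
noncomputable def convDenom (β : ℝ) (n : ℕ) : ℝ :=
  convMatrix β n 1 0 * gauss^[n] β + convMatrix β n 1 1

/-- As `phi` inverts representatives, `φ(T^n t₀)` is the symbol of the geodesic given by `convMatrix
β n`. -/
lemma shift_iterate_basePoint (G : Subgroup PGL(2, ℤ)) (β : ℝ) (n : ℕ) :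
    (shift G)^[n] (β, basePoint G) =
      (gauss^[n] β, ((Matrix.ProjGenLinGroup.mk (convMatrix β n)⁻¹ : PGL(2, ℤ)) : Cosets G)) := by
  induction n with
  | zero => simp [convMatrix, basePoint]
  | succ n ih =>
    rw [Function.iterate_succ_apply', ih, shift, Function.iterate_succ_apply']
    simp only [convMatrix, _root_.mul_inv_rev, inv_inv, map_mul]
    rfl

lemma gauss_mem {x : ℝ} (hx : Irrational x) :
    Irrational (gauss x) ∧ gauss x ∈ Set.Ioo (0 : ℝ) 1 := by
  have hirr : Irrational (1 / x - ⌊1 / x⌋) := by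
    rw [one_div]; exact hx.inv.sub_intCast _
  refine ⟨hirr, ?_, Int.fract_lt_one _⟩
  exact lt_of_le_of_ne (Int.fract_nonneg _) hirr.ne_zero.symm

lemma iterate_gauss_mem {β : ℝ} (hβ : Irrational β) (h : β ∈ Set.Ioo (0 : ℝ) 1) (n : ℕ) :
    Irrational (gauss^[n] β) ∧ gauss^[n] β ∈ Set.Ioo (0 : ℝ) 1 := by
  induction n with
  | zero => exact ⟨hβ, h⟩
  | succ n ih =>
    rw [Function.iterate_succ_apply']
    exact gauss_mem ih.1

/-- The integer part of `1 / y` is locally constant near an irrational `x`. -/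
lemma gauss_hasDerivAt {x : ℝ} (hx : Irrational x) : HasDerivAt gauss (-(x ^ 2)⁻¹) x := by
  have hx0 : x ≠ 0 := hx.ne_zero
  have h1 : HasDerivAt (fun y : ℝ => y⁻¹ - (⌊1 / x⌋ : ℝ)) (-(x ^ 2)⁻¹) x :=
    (hasDerivAt_inv hx0).sub_const _
  refine h1.congr_of_eventuallyEq ?_
  have hirr : Irrational (1 / x) := by rw [one_div]; exact hx.inv
  have hlt : (⌊1 / x⌋ : ℝ) < 1 / x :=
    lt_of_le_of_ne (Int.floor_le _) (hirr.ne_int _).symm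
  have hmem : Set.Ioo (⌊1 / x⌋ : ℝ) (⌊1 / x⌋ + 1) ∈ 𝓝 (1 / x) :=
    Ioo_mem_nhds hlt (Int.lt_floor_add_one _)
  have hc : ContinuousAt (fun y : ℝ => 1 / y) x := by
    simpa only [one_div] using continuousAt_inv₀ hx0
  filter_upwards [hc hmem] with y hy
  have : ⌊1 / y⌋ = ⌊1 / x⌋ := Int.floor_eq_iff.2 ⟨hy.1.le, hy.2⟩
  rw [gauss, this, one_div]

lemma convMatrix_succ_apply (β : ℝ) (n : ℕ) (i : Fin 2) :
    convMatrix β (n + 1) i 0 = convMatrix β n i 1 ∧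
    convMatrix β (n + 1) i 1 = convMatrix β n i 0 + ⌊1 / gauss^[n] β⌋ * convMatrix β n i 1 := by
  constructor
  · change ((convMatrix β n).val * !![0, 1; 1, ⌊1 / gauss^[n] β⌋]) i 0 = _
    simp [Matrix.mul_apply, Fin.sum_univ_two]
  · change ((convMatrix β n).val * !![0, 1; 1, ⌊1 / gauss^[n] β⌋]) i 1 = _
    simp [Matrix.mul_apply, Fin.sum_univ_two, mul_comm]

variable {β : ℝ}

lemma one_le_floor_inv {x : ℝ} (h : x ∈ Set.Ioo (0 : ℝ) 1) : 1 ≤ ⌊1 / x⌋ := by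
  rw [Int.le_floor, Int.cast_one, le_div_iff₀ h.1]
  linarith [h.2]

lemma convMatrix_bounds (hβ : Irrational β) (h : β ∈ Set.Ioo (0 : ℝ) 1) (n : ℕ) :
    0 ≤ convMatrix β n 1 0 ∧ convMatrix β n 1 0 ≤ convMatrix β n 1 1 ∧
      1 ≤ convMatrix β n 1 1 := by
  induction n with
  | zero => simp [convMatrix]
  | succ n ih =>
    obtain ⟨h0, h1⟩ := convMatrix_succ_apply β n 1
    rw [h0, h1]
    have ha := one_le_floor_inv (iterate_gauss_mem hβ h n).2
    obtain ⟨i1, i2, i3⟩ := ih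
    refine ⟨by linarith, ?_, ?_⟩ <;> nlinarith

/-- With `a = ⌊1 / x_n⌋`, the inverse shift matrix sends `(x_{n+1}, 1)` to `(1, a + x_{n+1}) = (1, 1
/ x_n)`. Row `1` gives `x_n D_{n+1} = D_n`; both rows together give `g_n • x_n = β`. -/
lemma mul_convDenom (hβ : Irrational β) (h : β ∈ Set.Ioo (0 : ℝ) 1) (n : ℕ) (i : Fin 2) :
    gauss^[n] β * (convMatrix β (n + 1) i 0 * gauss^[n + 1] β + convMatrix β (n + 1) i 1) =
      convMatrix β n i 0 * gauss^[n] β + convMatrix β n i 1 := by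
  obtain ⟨h0, h1⟩ := convMatrix_succ_apply β n i
  have hx := (iterate_gauss_mem hβ h n).2.1.ne'
  rw [h0, h1, Function.iterate_succ_apply', gauss]
  push_cast
  field_simp
  ring

lemma mul_convDenom_eq (hβ : Irrational β) (h : β ∈ Set.Ioo (0 : ℝ) 1) (n : ℕ) :
    β * convDenom β n = convMatrix β n 0 0 * gauss^[n] β + convMatrix β n 0 1 := by
  induction n with
  | zero => simp [convDenom, convMatrix]
  | succ n ih =>
    have hx := (iterate_gauss_mem hβ h n).2.1.ne'
    apply mul_left_cancel₀ hx
    rw [mul_convDenom hβ h n 0, ← ih, convDenom, convDenom, ← mul_convDenom hβ h n 1]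
    ring

lemma one_le_convDenom (hβ : Irrational β) (h : β ∈ Set.Ioo (0 : ℝ) 1) (n : ℕ) :
    1 ≤ convDenom β n := by
  obtain ⟨h0, -, h1⟩ := convMatrix_bounds hβ h n
  have hx := (iterate_gauss_mem hβ h n).2.1
  have h0' : (0 : ℝ) ≤ convMatrix β n 1 0 := by exact_mod_cast h0
  have h1' : (1 : ℝ) ≤ convMatrix β n 1 1 := by exact_mod_cast h1
  rw [convDenom]
  nlinarith [mul_nonneg h0' hx.le]

/-- Two steps give `D_n = x_n x_{n+1} D_{n+2}`. Here `x_n x_{n+1} = 1 - a x_n` with `a = ⌊1 / x_n⌋ ≥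
1`, and `1 < (a + 1) x_n ≤ 2 a x_n`. -/
lemma two_mul_convDenom_le (hβ : Irrational β) (h : β ∈ Set.Ioo (0 : ℝ) 1) (n : ℕ) :
    2 * convDenom β n ≤ convDenom β (n + 2) := by
  have e1 := mul_convDenom hβ h n 1
  have e2 := mul_convDenom hβ h (n + 1) 1
  have hD := one_le_convDenom hβ h (n + 2)
  change gauss^[n] β * convDenom β (n + 1) = convDenom β n at e1
  change gauss^[n + 1] β * convDenom β (n + 2) = convDenom β (n + 1) at e2
  have hx := (iterate_gauss_mem hβ h n).2
  have hx1 : gauss^[n] β * gauss^[n + 1] β ≤ 1 / 2 := by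
    have ha := one_le_floor_inv hx
    have hlt := Int.lt_floor_add_one (1 / gauss^[n] β)
    rw [Function.iterate_succ_apply', gauss]
    set x := gauss^[n] β
    have ha' : (1 : ℝ) ≤ ⌊1 / x⌋ := by exact_mod_cast ha
    rw [div_lt_iff₀ hx.1] at hlt
    rw [mul_sub, mul_one_div_cancel hx.1.ne']
    nlinarith [hx.1]
  rw [← e1, ← e2]
  nlinarith

lemma two_pow_le_convDenom (hβ : Irrational β) (h : β ∈ Set.Ioo (0 : ℝ) 1) (n : ℕ) :
    2 ^ n ≤ convDenom β (2 * n) := by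
  induction n with
  | zero => simpa using one_le_convDenom hβ h 0
  | succ n ih =>
    have := two_mul_convDenom_le hβ h (2 * n)
    rw [pow_succ, mul_add]
    linarith

/-- By the chain rule each step multiplies the derivative by `-1 / x_n ^ 2`, while `D_{n+1} = D_n /
x_n`. -/
lemma iterate_gauss_hasDerivAt (hβ : Irrational β) (h : β ∈ Set.Ioo (0 : ℝ) 1) (n : ℕ) :
    HasDerivAt (gauss^[n]) ((-1) ^ n * convDenom β n ^ 2) β := by
  induction n with
  | zero => simpa [convDenom, convMatrix] using hasDerivAt_id β
  | succ n ih =>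
    rw [Function.iterate_succ']
    have hx := iterate_gauss_mem hβ h n
    refine ((gauss_hasDerivAt hx.1).comp β ih).congr_deriv ?_
    have e1 := mul_convDenom hβ h n 1
    change gauss^[n] β * convDenom β (n + 1) = convDenom β n at e1
    rw [← e1]
    have := hx.2.1.ne'
    field_simp
    ring

lemma log_abs_deriv_iterate_gauss (hβ : Irrational β) (h : β ∈ Set.Ioo (0 : ℝ) 1) (n : ℕ) :
    Real.log |deriv (gauss^[n]) β| = 2 * Real.log (convDenom β n) := by
  rw [(iterate_gauss_hasDerivAt hβ h n).deriv, abs_mul, abs_pow, abs_neg, abs_one, one_pow,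
    one_mul, abs_of_nonneg (sq_nonneg _), Real.log_pow]
  norm_num

lemma mem_Ioo_of_mem_lyapunovLevel {c : ℝ} (h : β ∈ lyapunovLevel c) :
    β ∈ Set.Ioo (0 : ℝ) 1 :=
  ⟨lt_of_le_of_ne h.1.1 h.2.1.ne_zero.symm, lt_of_le_of_ne h.1.2 h.2.1.ne_one⟩

lemma tendsto_log_convDenom {c : ℝ} (h : β ∈ lyapunovLevel c) :
    Tendsto (fun n : ℕ => 2 * Real.log (convDenom β n) / n) atTop (𝓝 c) := by
  refine h.2.2.congr fun n => ?_
  rw [log_abs_deriv_iterate_gauss h.2.1 (mem_Ioo_of_mem_lyapunovLevel h)]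
  ring

/-- Lyapunov exponents are positive. -/
lemma pos_of_mem_lyapunovLevel {c : ℝ} (h : β ∈ lyapunovLevel c) : 0 < c := by
  have h2 : Tendsto (fun n : ℕ => 2 * n) atTop atTop :=
    tendsto_id.const_mul_atTop' (by norm_num)
  -- Along even indices `D_{2n} ≥ 2 ^ n`, which gives `c ≥ log 2`.
  refine (Real.log_pos one_lt_two).trans_le
    (ge_of_tendsto ((tendsto_log_convDenom h).comp h2) ?_)
  filter_upwards [eventually_gt_atTop 0] with n hn
  have hn' : (0 : ℝ) < n := by exact_mod_cast hn
  have := Real.log_le_log (by positivity)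
    (two_pow_le_convDenom h.2.1 (mem_Ioo_of_mem_lyapunovLevel h) n)
  rw [Real.log_pow] at this
  simp only [Function.comp_apply]
  rw [le_div_iff₀ (by positivity)]
  push_cast
  linarith

/-! ## Convergents and geodesics with the same end -/

lemma geodesic_sub_eq (g : GL (Fin 2) ℝ) (s β : ℝ) :
    ‖(geodesic g s : ℂ) - β‖ =
      ‖num g (⟨0, Real.exp s⟩ : ℂ) - β * denom g (⟨0, Real.exp s⟩ : ℂ)‖ /
        ‖denom g (⟨0, Real.exp s⟩ : ℂ)‖ := by
  have hd : denom g (⟨0, Real.exp s⟩ : ℂ) ≠ 0 := denom_ne_zero_of_im g (by simp)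
  rw [geodesic, coe_smul, ← norm_σ g, map_sub, σ_sq, σ_ofReal, ← norm_div]
  congr 1
  change num g (⟨0, Real.exp s⟩ : ℂ) / denom g (⟨0, Real.exp s⟩ : ℂ) - _ = _
  rw [sub_div, mul_div_cancel_right₀ _ hd]

lemma geodesic_im (g : GL (Fin 2) ℝ) (s : ℝ) :
    (geodesic g s).im = |g.det.val| * Real.exp s / ((g 1 0 * Real.exp s) ^ 2 + g 1 1 ^ 2) := by
  rw [geodesic, im_smul_eq_div_normSq]
  congr 1
  change Complex.normSq ((g 1 0 : ℂ) * (⟨0, Real.exp s⟩ : ℂ) + g 1 1) = _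
  rw [Complex.normSq_apply]
  simp
  ring

/-- With `β = γ 0 0 / γ 1 0`, the difference `γ(z) - β` is `-det / (γ 1 0 * denom γ z)`, up to
conjugation. Thus the geodesic at parameter `s` approaches `β` nontangentially at scale `exp (-s)`.
-/
lemma exists_near_of_endsAt {γ : GL (Fin 2) ℝ} {β : ℝ} (hγ : EndsAt γ β) :
    ∃ K k : ℝ, 0 ≤ K ∧ 0 < k ∧ ∀ s, 0 ≤ s →
      ‖(geodesic γ s : ℂ) - β‖ ≤ K * Real.exp (-s) ∧ k * Real.exp (-s) ≤ (geodesic γ s).im := by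
  have hc : γ 1 0 ≠ 0 := by
    intro h0
    rw [EndsAt, OnePoint.smul_infty_eq_ite, if_pos h0] at hγ
    exact OnePoint.infty_ne_coe _ hγ
  have hβ : β = γ 0 0 / γ 1 0 := by
    rw [EndsAt, OnePoint.smul_infty_eq_ite, if_neg hc] at hγ
    exact (OnePoint.coe_injective hγ).symm
  have hdet : 0 < |γ.det.val| := abs_pos.2 γ.det.ne_zero
  refine ⟨|γ.det.val| / γ 1 0 ^ 2, |γ.det.val| / (γ 1 0 ^ 2 + γ 1 1 ^ 2), by positivity,
    by positivity, fun s hs => ⟨?_, ?_⟩⟩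
  · have hcC : (γ 1 0 : ℂ) ≠ 0 := by exact_mod_cast hc
    have h1 : num γ (⟨0, Real.exp s⟩ : ℂ) - β * denom γ (⟨0, Real.exp s⟩ : ℂ) =
        ((-γ.det.val / γ 1 0 : ℝ) : ℂ) := by
      rw [hβ, num, denom, Matrix.GeneralLinearGroup.val_det_apply, Matrix.det_fin_two]
      push_cast
      field_simp
      ring
    have h2 : |γ 1 0| * Real.exp s ≤ ‖denom γ (⟨0, Real.exp s⟩ : ℂ)‖ := by
      refine le_trans (le_of_eq ?_) (Complex.abs_im_le_norm _)
      simp [denom, abs_mul]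
    have hca : 0 < |γ 1 0| := abs_pos.2 hc
    rw [geodesic_sub_eq, h1, Complex.norm_real, Real.norm_eq_abs, abs_div, abs_neg]
    calc |γ.det.val| / |γ 1 0| / ‖denom γ (⟨0, Real.exp s⟩ : ℂ)‖
        ≤ |γ.det.val| / |γ 1 0| / (|γ 1 0| * Real.exp s) := by gcongr
      _ = _ := by
        rw [Real.exp_neg, ← sq_abs (γ 1 0)]
        field_simp
  · rw [geodesic_im]
    have he : 1 ≤ Real.exp s := Real.one_le_exp hs
    have hpos : 0 < (γ 1 0 * Real.exp s) ^ 2 + γ 1 1 ^ 2 := by positivity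
    rw [Real.exp_neg, div_mul_eq_mul_div, ← div_eq_mul_inv, div_div,
      div_le_div_iff₀ (by positivity) hpos, mul_assoc]
    refine mul_le_mul_of_nonneg_left ?_ hdet.le
    have : γ 1 1 ^ 2 * 1 ≤ γ 1 1 ^ 2 * (Real.exp s * Real.exp s) := by
      gcongr
      nlinarith
    nlinarith

/-- Since `β = g_n(x_n)`, the distance from `g_n(i)` to `β` is `|i - x_n| / (D_n |denom g_n i|)`.
The lower row `(q', q)` satisfies `0 ≤ q' ≤ q ≤ D_n ≤ 2q`, hence the constants `4` and `1 / 2`. -/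
lemma convMatrix_near {β : ℝ} (hβ : Irrational β) (h : β ∈ Set.Ioo (0 : ℝ) 1) (n : ℕ) :
    ‖(geodesic (toReal (convMatrix β n)) 0 : ℂ) - β‖ ≤ 4 * (convDenom β n ^ 2)⁻¹ ∧
      1 / 2 * (convDenom β n ^ 2)⁻¹ ≤ (geodesic (toReal (convMatrix β n)) 0).im := by
  obtain ⟨h0, h1, h2⟩ := convMatrix_bounds hβ h n
  have hD1 := one_le_convDenom hβ h n
  have heq := mul_convDenom_eq hβ h n
  have hx := (iterate_gauss_mem hβ h n).2
  have hdet : (toReal (convMatrix β n)).det.val =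
      (convMatrix β n 0 0 : ℝ) * convMatrix β n 1 1 -
        convMatrix β n 0 1 * convMatrix β n 1 0 := by
    rw [Matrix.GeneralLinearGroup.val_det_apply, Matrix.det_fin_two]
    rfl
  have habs : |(toReal (convMatrix β n)).det.val| = 1 := by
    have : |(convMatrix β n).det.val| = 1 :=
      Int.isUnit_iff_abs_eq.1 (convMatrix β n).det.isUnit
    rw [Matrix.GeneralLinearGroup.val_det_apply, Matrix.det_fin_two] at this
    rw [hdet]
    exact_mod_cast this
  have ec : toReal (convMatrix β n) 1 0 = (convMatrix β n 1 0 : ℝ) := rfl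
  have ed : toReal (convMatrix β n) 1 1 = (convMatrix β n 1 1 : ℝ) := rfl
  have ea : toReal (convMatrix β n) 0 0 = (convMatrix β n 0 0 : ℝ) := rfl
  have eb : toReal (convMatrix β n) 0 1 = (convMatrix β n 0 1 : ℝ) := rfl
  have hI : (⟨0, Real.exp 0⟩ : ℂ) = Complex.I := by rw [coe_mk_exp]; simp
  have hDdef : convDenom β n = convMatrix β n 1 0 * gauss^[n] β + convMatrix β n 1 1 := rfl
  set D := convDenom β n
  set x := gauss^[n] β
  set g := toReal (convMatrix β n)
  have h0' : (0 : ℝ) ≤ convMatrix β n 1 0 := by exact_mod_cast h0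
  have h1' : (convMatrix β n 1 0 : ℝ) ≤ convMatrix β n 1 1 := by exact_mod_cast h1
  have h2' : (1 : ℝ) ≤ convMatrix β n 1 1 := by exact_mod_cast h2
  have hDle : D ≤ 2 * convMatrix β n 1 1 := by nlinarith [hx.1, hx.2]
  have hDge : (convMatrix β n 1 1 : ℝ) ≤ D := by nlinarith [hx.1, hx.2]
  have hDpos : 0 < D := by linarith
  constructor
  · have hnum : num g Complex.I - β * denom g Complex.I =
        ((g.det.val : ℝ) : ℂ) * (Complex.I - x) / D := by
      have hDC : (D : ℂ) ≠ 0 := by exact_mod_cast hDpos.ne'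
      have hβ' : (β : ℂ) = (convMatrix β n 0 0 * x + convMatrix β n 0 1) / D := by
        rw [eq_div_iff hDC]; exact_mod_cast heq
      rw [hβ', eq_div_iff hDC, sub_mul, mul_right_comm, div_mul_cancel₀ _ hDC, num, denom, hdet,
        ea, eb, ec, ed, hDdef]
      push_cast
      ring
    have hden : (convMatrix β n 1 1 : ℝ) ≤ ‖denom g Complex.I‖ := by
      refine le_trans ?_ (Complex.abs_re_le_norm _)
      refine le_trans (le_abs_self _) (le_of_eq ?_)
      rw [denom, ec, ed]
      simp
    have hIx : ‖Complex.I - (x : ℂ)‖ ≤ 2 := by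
      refine (norm_sub_le _ _).trans ?_
      rw [Complex.norm_I, Complex.norm_real, Real.norm_eq_abs, abs_of_pos hx.1]
      linarith [hx.2]
    rw [geodesic_sub_eq, hI, hnum, norm_div, norm_mul, Complex.norm_real, Complex.norm_real,
      Real.norm_eq_abs, Real.norm_eq_abs, habs, one_mul, abs_of_pos hDpos]
    calc ‖Complex.I - (x : ℂ)‖ / D / ‖denom g Complex.I‖ ≤ 2 / D / (D / 2) := by
          gcongr
          linarith
      _ = 4 * (D ^ 2)⁻¹ := by field_simp; norm_num
  · rw [geodesic_im, habs, ec, ed, Real.exp_zero, mul_one, mul_one, one_div, ← mul_inv, one_div]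
    gcongr
    nlinarith

/-! ## The limits -/

/-- A Lipschitz function changes by `o(n)` between `u n` and `c * n`, and by `O(1)` between
consecutive multiples of `c`; so its linear growth rate can be read off at the `u n`. -/
lemma tendsto_inv_mul_iff {A : ℝ → ℝ} {M : ℝ} (hM : 0 ≤ M)
    (hA : ∀ s t, |A s - A t| ≤ M * |s - t|) {c : ℝ} (hc : 0 < c) {u S : ℕ → ℝ} {K : ℝ}
    (hu : Tendsto (fun n => u n / n) atTop (𝓝 c)) (hS : ∀ n, |S n - A (u n)| ≤ K) (l : ℝ) :
    Tendsto (fun τ : ℝ => τ⁻¹ * (A τ - A 0)) atTop (𝓝 l) ↔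
      Tendsto (fun n : ℕ => 1 / (c * n) * S n) atTop (𝓝 l) := by
  have hcn : Tendsto (fun n : ℕ => c * (n : ℝ)) atTop atTop :=
    tendsto_natCast_atTop_atTop.const_mul_atTop hc
  have hdiff : Tendsto (fun n : ℕ => 1 / (c * n) * S n - (c * (n : ℝ))⁻¹ * (A (c * n) - A 0))
      atTop (𝓝 0) := by
    have hb : Tendsto (fun n : ℕ => (K + |A 0|) / (c * n) + M / c * |u n / n - c|) atTop
        (𝓝 0) := by
      have h1 := (tendsto_const_nhds (x := K + |A 0|)).div_atTop hcn
      have h2 := ((hu.sub_const c).abs).const_mul (M / c)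
      simpa using h1.add h2
    refine squeeze_zero_norm' ?_ hb
    filter_upwards [eventually_gt_atTop 0] with n hn
    have hn' : (0 : ℝ) < n := by exact_mod_cast hn
    have e1 : |u n - c * n| = n * |u n / n - c| := by
      rw [← abs_of_pos hn', ← abs_mul, abs_of_pos hn']
      congr 1
      field_simp
    have h3 : |S n - (A (c * n) - A 0)| ≤ K + |A 0| + M * (n * |u n / n - c|) := by
      rw [← e1]
      have a1 := hS n
      have a2 := hA (u n) (c * n)
      rw [abs_le] at a1 a2 ⊢
      have a3 := le_abs_self (A 0)
      have a4 := neg_abs_le (A 0)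
      constructor <;> linarith [a1.1, a1.2, a2.1, a2.2]
    rw [one_div, ← mul_sub, Real.norm_eq_abs, abs_mul, abs_of_pos (by positivity)]
    calc (c * (n : ℝ))⁻¹ * |S n - (A (c * n) - A 0)|
        ≤ (c * (n : ℝ))⁻¹ * (K + |A 0| + M * (n * |u n / n - c|)) := by gcongr
      _ = _ := by field_simp
  constructor
  · intro h
    simpa using (h.comp hcn).add hdiff
  · intro h
    have h1 : Tendsto (fun n : ℕ => (c * (n : ℝ))⁻¹ * (A (c * n) - A 0)) atTop (𝓝 l) := by
      simpa using h.sub hdiff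
    -- The real parameter `τ` is compared with the sample point `c * ⌊τ / c⌋₊`, at distance less
    -- than `c`.
    have hfl : Tendsto (fun τ : ℝ => ⌊τ / c⌋₊) atTop atTop :=
      tendsto_nat_floor_atTop.comp (tendsto_id.atTop_div_const hc)
    have h2 := h1.comp hfl
    have h3 : Tendsto (fun τ : ℝ => c * ((⌊τ / c⌋₊ : ℝ) / τ)) atTop (𝓝 1) := by
      have := (tendsto_nat_floor_div_atTop (R := ℝ)).comp
        (tendsto_id.atTop_div_const hc : Tendsto (fun τ : ℝ => τ / c) atTop atTop)
      refine this.congr fun τ => ?_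
      simp only [Function.comp_apply]
      field_simp
    have h4 : Tendsto (fun τ : ℝ => τ⁻¹ * (A τ - A (c * ⌊τ / c⌋₊))) atTop (𝓝 0) := by
      have hb : Tendsto (fun τ : ℝ => M * c / τ) atTop (𝓝 0) :=
        tendsto_const_nhds.div_atTop tendsto_id
      refine squeeze_zero_norm' ?_ hb
      filter_upwards [eventually_gt_atTop 0] with τ hτ
      have f1 : c * (⌊τ / c⌋₊ : ℝ) ≤ τ := by
        have := Nat.floor_le (div_nonneg hτ.le hc.le)
        rw [le_div_iff₀ hc] at this
        linarith
      have f2 : τ < c * (⌊τ / c⌋₊ : ℝ) + c := by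
        have := Nat.lt_floor_add_one (τ / c)
        rw [div_lt_iff₀ hc] at this
        linarith
      rw [Real.norm_eq_abs, abs_mul, abs_of_pos (inv_pos.2 hτ), ← div_eq_inv_mul]
      gcongr
      refine (hA _ _).trans ?_
      gcongr
      rw [abs_of_nonneg] <;> linarith
    have h5 := (h3.mul h2).add h4
    rw [one_mul, add_zero] at h5
    refine h5.congr' ?_
    filter_upwards [eventually_ge_atTop c] with τ hτ
    have hτ0 : 0 < τ := hc.trans_le hτ
    have hf : 0 < (⌊τ / c⌋₊ : ℝ) := by
      have : 0 < ⌊τ / c⌋₊ := Nat.floor_pos.2 (by rwa [le_div_iff₀ hc, one_mul])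
      exact_mod_cast this
    simp only [Function.comp_apply]
    field_simp
    ring

lemma tendsto_realHomology_iff {G : Subgroup PGL(2, ℤ)} {ι : Type*} {l : Filter ι}
    {F : ι → RealHomology G} {C : RealHomology G} :
    Tendsto F l (𝓝 C) ↔ ∀ f, Tendsto (fun i => (F i).eval f) l (𝓝 (C.eval f)) := by
  have hind : Topology.IsInducing (fun C : RealHomology G => C.eval) := ⟨rfl⟩
  rw [hind.tendsto_nhds_iff, tendsto_pi_nhds]
  rfl

/-- Evaluation of homology classes on a differential, as a linear map. -/
noncomputable def evalLinear {G : Subgroup PGL(2, ℤ)} (f : FirstKind G) : RealHomology G →ₗ[ℝ] ℝ where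
  toFun C := C.eval f
  map_add' _ _ := rfl
  map_smul' _ _ := rfl

variable [G.FiniteIndex]

/-- The partial sums of `φ` along the orbit telescope. -/
lemma IsPotential.eval_sum_phi (h : IsPotential f Φ M) (β : ℝ) (n : ℕ) :
    (∑ k ∈ Finset.Icc 1 n, phi G ((shift G)^[k] (β, basePoint G)).2).eval f =
      cuspValue f Φ (convMatrix β 1) - cuspValue f Φ (convMatrix β n * flip) := by
  change evalLinear f _ = _
  induction n with
  | zero =>
    -- The sum is empty, and both cusp values on the right belong to the cusp `0`.
    rw [show cuspValue f Φ (convMatrix β 1) = _ from h.cuspValue_mul_flip (convMatrix β 0) _]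
    simp
  | succ n ih =>
    rw [Finset.sum_Icc_succ_top (by lia), map_add, ih, shift_iterate_basePoint]
    change _ + (phi G _).eval f = _
    rw [phi_eval, inv_inv, h.integral_eq_cuspValue_sub,
      show cuspValue f Φ (convMatrix β (n + 1)) = _ from h.cuspValue_mul_flip (convMatrix β n) _]
    ring

lemma IsPotential.exists_abs_sub_le (h : IsPotential f Φ M) {β : ℝ} (hβ : Irrational β)
    (hβ' : β ∈ Set.Ioo (0 : ℝ) 1) {γ : GL (Fin 2) ℝ} (hγ : EndsAt γ β) :
    ∃ K, ∀ n : ℕ, |(-∑ k ∈ Finset.Icc 1 n, phi G ((shift G)^[k] (β, basePoint G)).2).eval f -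
      Φ (geodesic γ (2 * Real.log (convDenom β n)))| ≤ K := by
  obtain ⟨B, hB⟩ := exists_integral_Ioi_le f
  obtain ⟨K, k, hK, hk, hnear⟩ := exists_near_of_endsAt hγ
  have hM := h.nonneg
  -- The three terms pay for passing from the geodesic to `g_n(i)`, from `g_n(i)` to the cusp
  -- `g_n(0)`, and for the fixed value at the cusp `0`.
  refine ⟨M / min k (1 / 2) * (4 + K) + B + |cuspValue f Φ (convMatrix β 1)|, fun n => ?_⟩
  have e1 : (-∑ k ∈ Finset.Icc 1 n, phi G ((shift G)^[k] (β, basePoint G)).2).eval f =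
      cuspValue f Φ (convMatrix β n * flip) - cuspValue f Φ (convMatrix β 1) := by
    rw [← neg_sub, ← h.eval_sum_phi]; rfl
  have hD := one_le_convDenom hβ hβ' n
  have hDpos : 0 < convDenom β n := by linarith
  obtain ⟨n1, n2⟩ := hnear (2 * Real.log (convDenom β n))
    (mul_nonneg zero_le_two (Real.log_nonneg hD))
  obtain ⟨m1, m2⟩ := convMatrix_near hβ hβ' n
  have hexp : Real.exp (-(2 * Real.log (convDenom β n))) = (convDenom β n ^ 2)⁻¹ := by
    rw [Real.exp_neg, two_mul, Real.exp_add, Real.exp_log hDpos, sq]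
  rw [hexp] at n1 n2
  set D := convDenom β n
  set z := geodesic (toReal (convMatrix β n)) 0 with hz
  set w := geodesic γ (2 * Real.log D)
  have hkm : 0 < min k (1 / 2) := lt_min hk (by norm_num)
  have hDi : 0 < (D ^ 2)⁻¹ := by positivity
  -- Height and Euclidean distance both scale like `D⁻²`, so `D` cancels from the estimate.
  have hzw : |Φ z - Φ w| ≤ M / min k (1 / 2) * (4 + K) := by
    refine (h.sub_le (min k (1 / 2) * (D ^ 2)⁻¹) z w (by positivity)
      (le_trans (by gcongr; exact min_le_right _ _) m2)
      (le_trans (by gcongr; exact min_le_left _ _) n2)).trans ?_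
    have hd : dist (z : ℂ) w ≤ (4 + K) * (D ^ 2)⁻¹ := by
      refine (dist_triangle_right (z : ℂ) w β).trans ?_
      rw [dist_eq_norm, dist_eq_norm]
      linarith
    calc M / (min k (1 / 2) * (D ^ 2)⁻¹) * dist (z : ℂ) w
        ≤ M / (min k (1 / 2) * (D ^ 2)⁻¹) * ((4 + K) * (D ^ 2)⁻¹) := by gcongr
      _ = _ := by field_simp
  have hcusp : cuspValue f Φ (convMatrix β n * flip) =
      Φ z + ∫ s in Set.Ioi 0, integrand f (toReal (convMatrix β n * flip)) s := by
    rw [cuspValue, geodesic_flip, neg_zero]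
  rw [e1, hcusp]
  have hB' := hB (convMatrix β n * flip)
  have a1 := le_abs_self (cuspValue f Φ (convMatrix β 1))
  have a2 := neg_abs_le (cuspValue f Φ (convMatrix β 1))
  rw [abs_le] at hzw hB' ⊢
  constructor <;> linarith [hzw.1, hzw.2, hB'.1, hB'.2]

end LMS

theorem theorem2p1 (G : Subgroup PGL(2, ℤ)) [G.FiniteIndex] (c : ℝ) (β : ℝ)
    (hβ : β ∈ LMS.lyapunovLevel c) (γ : GL (Fin 2) ℝ) (hγ : LMS.EndsAt γ β)
    (C : LMS.RealHomology G) :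
    LMS.IsLimitingSymbol G γ C ↔
      Tendsto (fun n : ℕ => -((1 / (c * n)) •
        ∑ k ∈ Finset.Icc 1 n, LMS.phi G ((LMS.shift G)^[k] (β, LMS.basePoint G)).2))
        atTop (𝓝 C) := by
  rw [LMS.IsLimitingSymbol, LMS.tendsto_realHomology_iff, LMS.tendsto_realHomology_iff]
  refine forall_congr' fun f => ?_
  obtain ⟨Φ, M, h⟩ := LMS.exists_isPotential f
  obtain ⟨K, hK⟩ := h.exists_abs_sub_le hβ.2.1 (LMS.mem_Ioo_of_mem_lyapunovLevel hβ) hγ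
  -- Here `A` is `Φ` along the geodesic, `u n = 2 log D_n`, and `S n` is the negative of the partial
  -- sum of `φ`, evaluated on `f`.
  have key := LMS.tendsto_inv_mul_iff h.nonneg (h.abs_geodesic_sub_le γ)
    (LMS.pos_of_mem_lyapunovLevel hβ) (LMS.tendsto_log_convDenom hβ) hK (C.eval f)
  have e1 : ∀ τ : ℝ, (τ⁻¹ • LMS.arcSymbol G γ 0 τ).eval f =
      τ⁻¹ * (Φ (LMS.geodesic γ τ) - Φ (LMS.geodesic γ 0)) := fun τ => by
    rw [← h.integral_integrand]; rfl
  simp only [← smul_neg, e1]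
  exact key
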